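/- Let $k\in\omega$. In the language of set theory $\{\in\}$ (first-order logic with equality), let $S_k$ be the theory axiomatized by - for $n=0$ and $n=k$: $\forall x_0,\dots,x_{n-1}\,\exists y\,\forall t\,\bigl(t\in y\leftrightarrow\bigvee_{i<n}t=x_i\bigr)$; - extensionality: $\forall x,y\,\bigl(\forall t\,(t\in x\leftrightarrow t\in y)\to x=y\bigr)$; - boundedness: $\forall x,u_0,\dots,u_k\,\bigl(\bigwedge_{i\le k}u_i\in x\to\bigvee_{i<j\le k}u_i=u_j\bigr)$; - for each $n\ge1$: $\forall x_0,\dots,x_n\,\neg\bigl(\bigwedge_{i<n}x_i\in x_{i+1}\land x_n=x_0\bigr)$. For a model $\mathbf A=\langle A,\in^{\mathbf A}\rangle$ of $S_k$ and a tuple $\bar a=(a_0,\dots,a_{l-1})$ in $A$, put $\mathrm{tc}_0(\bar a)=\{a_i:i<l\}$, $\mathrm{tc}_{n+1}(\bar a)=\mathrm{tc}_n(\bar a)\cup\{v\in A:v\in^{\mathbf A}u\text{ for some }u\in\mathrm{tc}_n(\bar a)\}$, and $\mathrm{tc}(\bar a)=\bigcup_n\mathrm{tc}_n(\bar a)$.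 For tuples $\bar a$ in $\mathbf A$ and $\bar b$ in $\mathbf B$ of the same length $l$, write - $\mathbf A,\bar a\equiv\mathbf B,\bar b$ if $\bar a$ and $\bar b$ satisfy the same first-order formulas, and $\mathbf A,\bar a\equiv_n\mathbf B,\bar b$ if they satisfy the same formulas of quantifier rank at most $n$; - $\mathbf A,\bar a\sim\mathbf B,\bar b$ if the (possibly empty) pointed structures $\langle\mathrm{tc}(\bar a),\in^{\mathbf A},\bar a\rangle$ and $\langle\mathrm{tc}(\bar b),\in^{\mathbf B},\bar b\rangle$ are isomorphic, and $\mathbf A,\bar a\sim_n\mathbf B,\bar b$ if $\langle\mathrm{tc}_n(\bar a),\in^{\mathbf A},\bar a\rangle$ and $\langle\mathrm{tc}_n(\bar b),\in^{\mathbf B},\bar b\rangle$ are isomorphic (isomorphisms map $a_i$ to $b_i$ for each $i<l$). Let $k^{\le n}=\sum_{i=0}^nk^i$ (with $0^0=1$), and define $t_k(0)=0$, $t_k(n+1)=k^{\le t_k(n)+1}+t_k(n)+1$. **Theorem.** Let $\mathbf A,\mathbf B\models S_k$, and let $\bar a$ in $A$ and $\bar b$ in $B$ be tuples of the same length $l\ge0$.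 Then $$\mathbf A,\bar a\equiv\mathbf B,\bar b\iff\mathbf A,\bar a\sim\mathbf B,\bar b.$$ More precisely, for all $n\in\omega$, $$\mathbf A,\bar a\equiv_{l(k^{\le n}-1)}\mathbf B,\bar b\implies\mathbf A,\bar a\sim_n\mathbf B,\bar b,$$ $$\mathbf A,\bar a\sim_{t_k(n)}\mathbf B,\bar b\implies\mathbf A,\bar a\equiv_n\mathbf B,\bar b.$$ -/

import Mathlib

open FirstOrder FirstOrder.Language

namespace HSets

/-! ### The language of set theory and the theory of sets of size at most `k` -/

/-- The only symbol of the language of set theory: the binary relation symbol of membership. -/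
inductive SetRel : ℕ → Type
  | mem : SetRel 2

/-- The first-order language with one binary relation symbol. -/
def setLang : FirstOrder.Language.{0, 0} := ⟨fun _ => Empty, SetRel⟩

/-- The membership symbol. -/
def memSym : setLang.Relations 2 := SetRel.mem

/-- The atomic formula `x_i ∈ x_j` in the bound variables. -/
def memF {m : ℕ} (i j : Fin m) : setLang.BoundedFormula Empty m :=
  memSym.boundedFormula₂ (Term.var (Sum.inr i)) (Term.var (Sum.inr j))

/-- The atomic formula `x_i = x_j` in the bound variables. -/
def eqF {m : ℕ} (i j : Fin m) : setLang.BoundedFormula Empty m :=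
  Term.bdEqual (Term.var (Sum.inr i)) (Term.var (Sum.inr j))

/-- `∀ x_0, …, x_{n-1} ∃ y ∀ t (t ∈ y ↔ ⋁_{i<n} t = x_i)`;
here `y` is variable number `n` and `t` is variable number `n + 1`. -/
noncomputable def axV (n : ℕ) : setLang.Sentence :=
  BoundedFormula.alls (n := n)
    (∃' ∀' ((memF (Fin.last (n + 1)) (Fin.last n).castSucc).iff
      (BoundedFormula.iSup fun i : Fin n => eqF (Fin.last (n + 1)) i.castSucc.castSucc)))

/-- Extensionality: `∀ x, y (∀ t (t ∈ x ↔ t ∈ y) → x = y)`. -/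
def axE : setLang.Sentence :=
  ∀' ∀' ((∀' ((memF (m := 3) 2 0).iff (memF 2 1))).imp (eqF (m := 2) 0 1))

/-- Boundedness: `∀ x, u_0, …, u_k (⋀_{i≤k} u_i ∈ x → ⋁_{i<j≤k} u_i = u_j)`;
here `x` is variable number `0` and `u_i` is variable number `i + 1`. -/
noncomputable def axB (k : ℕ) : setLang.Sentence :=
  BoundedFormula.alls (n := k + 2)
    ((BoundedFormula.iInf fun i : Fin (k + 1) => memF i.succ 0).imp
      (BoundedFormula.iSup fun p : {p : Fin (k + 1) × Fin (k + 1) // p.1 < p.2} =>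
        eqF p.1.1.succ p.1.2.succ))

/-- No `∈`-cycles of length `n`: `∀ x_0, …, x_n ¬ (⋀_{i<n} x_i ∈ x_{i+1} ∧ x_n = x_0)`. -/
noncomputable def axC (n : ℕ) : setLang.Sentence :=
  BoundedFormula.alls (n := n + 1)
    (((BoundedFormula.iInf fun i : Fin n => memF i.castSucc i.succ) ⊓ eqF (Fin.last n) 0).not)

/-- The theory `S_k`. -/
def theoryS (k : ℕ) : setLang.Theory :=
  {axV 0, axV k, axE, axB k} ∪ {φ | ∃ n : ℕ, 1 ≤ n ∧ φ = axC n}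

/-! ### Quantifier rank and elementary equivalence of tuples -/

/-- Quantifier rank. The primitives of `BoundedFormula` are `⊥`, equality, relations, `→`, `∀`;
the other connectives and `∃` are abbreviations, on which this gives the usual values. -/
def qrank {L : FirstOrder.Language} {α : Type*} : {m : ℕ} → L.BoundedFormula α m → ℕ
  | _, .falsum => 0
  | _, .equal _ _ => 0
  | _, .rel _ _ => 0
  | _, .imp φ ψ => max (qrank φ) (qrank ψ)
  | _, .all φ => qrank φ + 1

section

variable {A B : Type*} [setLang.Structure A] [setLang.Structure B] {l : ℕ}

/-- `A, a ≡ B, b`: the tuples satisfy the same formulas. -/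
def ElemEquiv (a : Fin l → A) (b : Fin l → B) : Prop :=
  ∀ φ : setLang.Formula (Fin l), φ.Realize a ↔ φ.Realize b

/-- `A, a ≡_n B, b`: the tuples satisfy the same formulas of quantifier rank at most `n`. -/
def ElemEquivRank (n : ℕ) (a : Fin l → A) (b : Fin l → B) : Prop :=
  ∀ φ : setLang.Formula (Fin l), qrank φ ≤ n → (φ.Realize a ↔ φ.Realize b)

/-! ### Transitive closures and their isomorphism -/

/-- The extension of `u`: the set of all `v` with `v ∈ u` in the structure. -/
def extension (u : A) : Set A :=
  {v | Structure.RelMap memSym ![v, u]}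

/-- The levels of the transitive closure of a tuple. -/
def tclLevel (a : Fin l → A) : ℕ → Set A
  | 0 => Set.range a
  | n + 1 => tclLevel a n ∪ ⋃ u ∈ tclLevel a n, extension u

/-- The transitive closure of a tuple. -/
def tcl (a : Fin l → A) : Set A := ⋃ n, tclLevel a n

/-- Any subset of a structure in the (relational) language of set theory is (the domain of) a
substructure, with the restricted membership relation. -/
def toSubstructure (X : Set A) : setLang.Substructure A where
  carrier := X
  fun_mem f := f.elim

/-- For `X ⊆ A`, `Y ⊆ B`: the structures `⟨X, ∈, a⟩` and `⟨Y, ∈, b⟩` are isomorphic, where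
`a` is a tuple in `X` and `b` is a tuple in `Y`. -/
def PointedIso (X : Set A) (Y : Set B) (a : Fin l → A) (b : Fin l → B) : Prop :=
  ∃ f : toSubstructure X ≃[setLang] toSubstructure Y,
    ∀ i, ∃ h : a i ∈ toSubstructure X, (f ⟨a i, h⟩ : B) = b i

/-- `A, a ∼_n B, b`: the pointed `n`-th levels of the transitive closures are isomorphic. -/
def TclLevelIso (n : ℕ) (a : Fin l → A) (b : Fin l → B) : Prop :=
  PointedIso (tclLevel a n) (tclLevel b n) a b

/-- `A, a ∼ B, b`: the pointed transitive closures are isomorphic. -/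
def TclIso (a : Fin l → A) (b : Fin l → B) : Prop :=
  PointedIso (tcl a) (tcl b) a b

end

/-! ### The numerical functions -/

/-- `k^{≤ n} = ∑_{i=0}^n k^i` (always at least `1`, as `k^0 = 1`). -/
def powLE (k n : ℕ) : ℕ := ∑ i ∈ Finset.range (n + 1), k ^ i

/-- `t_k(0) = 0`, `t_k(n+1) = k^{≤ t_k(n)+1} + t_k(n) + 1`. -/
def tBound (k : ℕ) : ℕ → ℕ
  | 0 => 0
  | n + 1 => powLE k (tBound k n + 1) + tBound k n + 1

end HSets

/-! The axioms say that membership is extensional and acyclic, and that the extensions are exactly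
the subsets of size at most k. So tc_n of an l-tuple has at most l·k^{≤n} elements. Hence l(k^{≤n} −
1) existential quantifiers suffice to list tc_n(a) outside the tuple, and the diagram of the list
yields an embedding of tc_n(a) into tc_n(b). By symmetry and finiteness it is onto. The other
direction is an Ehrenfeucht–Fraïssé argument resting on `IsLevelIso.exists_extend`. Let f be an
isomorphism of levels T = N + t + 1 with N = k^{≤t+1}, and let c be a new point. As X = tc_{t+1}(c)
has at most N elements, some depth s ≥ t has a gap: X meets levels s and s + 1 of the old tuple in
the same set. Keep f on level s, rebuild the rest of tc_t(c) from below as sets of images, and send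
the remaining points of X to widely spaced iterated singletons of B outside level T. The levels
between s and T ensure that no new point lands in the image of level s + 1; the spacing prevents
collisions among the new points. For the whole closure, each formula needs only one finite level;
conversely, the levels are finite, so isomorphisms of all of them have a limit along an ultrafilter.
-/

namespace HSets

/-! ### Semantic content of the axioms -/

variable {A : Type*} [setLang.Structure A]

/-- The semantic content of `theoryS k`. -/
structure IsBoundedSetModel (k : ℕ) (A : Type*) [setLang.Structure A] : Prop where
  exists_extension_eq : ∀ Y : Set A, Y.Finite → Y.ncard ≤ k → ∃ y : A, extension y = Y
  extension_injective : Function.Injective (extension : A → Set A)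
  finite_extension : ∀ u : A, (extension u).Finite
  ncard_extension_le : ∀ u : A, (extension u).ncard ≤ k
  acyclic : ∀ x : A, ¬ Relation.TransGen (fun v u : A => v ∈ extension u) x x

lemma mem_extension_iff {u v : A} : v ∈ extension u ↔ Structure.RelMap memSym ![v, u] :=
  Iff.rfl

lemma realize_memF {m : ℕ} (i j : Fin m) (v : Empty → A) (xs : Fin m → A) :
    (memF i j).Realize v xs ↔ xs i ∈ extension (xs j) := by
  simp [memF, extension, BoundedFormula.realize_rel₂]

lemma realize_eqF {m : ℕ} (i j : Fin m) (v : Empty → A) (xs : Fin m → A) :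
    (eqF i j).Realize v xs ↔ xs i = xs j := by
  simp [eqF]

lemma realize_sentence_alls {n : ℕ} (φ : setLang.BoundedFormula Empty n) :
    A ⊨ φ.alls ↔ ∀ xs : Fin n → A, φ.Realize default xs :=
  BoundedFormula.realize_alls

lemma exists_extension_eq_range {n : ℕ} (h : A ⊨ axV n) (x : Fin n → A) :
    ∃ y : A, extension y = Set.range x := by
  simp only [axV, realize_sentence_alls,
    BoundedFormula.realize_ex, BoundedFormula.realize_all, BoundedFormula.realize_iff,
    BoundedFormula.realize_iSup, realize_memF, realize_eqF] at h
  obtain ⟨y, hy⟩ := h x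
  refine ⟨y, Set.ext fun t => ?_⟩
  have := hy t
  simp only [Fin.snoc_last, Fin.snoc_castSucc] at this
  rw [this]
  simp [eq_comm]

lemma extension_injective_of_realize (h : A ⊨ axE) :
    Function.Injective (extension : A → Set A) := by
  intro x y hxy
  simp only [axE, Sentence.Realize, Formula.Realize,
    BoundedFormula.realize_all, BoundedFormula.realize_iff, BoundedFormula.realize_imp,
    realize_memF, realize_eqF] at h
  exact h x y fun t => by
    change t ∈ extension x ↔ t ∈ extension y
    rw [hxy]

lemma not_injective_of_realize {k : ℕ} (h : A ⊨ axB k) (x : A) (u : Fin (k + 1) → A)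
    (hu : ∀ i, u i ∈ extension x) : ¬ Function.Injective u := by
  intro hinj
  simp only [axB, realize_sentence_alls,
    BoundedFormula.realize_imp, BoundedFormula.realize_iInf,
    BoundedFormula.realize_iSup, realize_memF, realize_eqF] at h
  obtain ⟨⟨p, hp⟩, hpe⟩ := h (Fin.cons x u) (by simpa using hu)
  simp only [Fin.cons_succ] at hpe
  exact hp.ne (hinj hpe)

lemma finite_extension_and_ncard_le {k : ℕ} (h : A ⊨ axB k) (x : A) :
    (extension x).Finite ∧ (extension x).ncard ≤ k := by
  by_contra hcon
  have : ∃ s : Finset A, s.card = k + 1 ∧ (s : Set A) ⊆ extension x := by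
    by_cases hf : (extension x).Finite
    · have hk : k + 1 ≤ (extension x).ncard := by
        by_contra hlt
        exact hcon ⟨hf, by omega⟩
      rw [Set.ncard_eq_toFinset_card _ hf] at hk
      obtain ⟨s, hs, hsc⟩ := Finset.exists_subset_card_eq hk
      exact ⟨s, hsc, fun z hz => by simpa using hs hz⟩
    · obtain ⟨s, hs, hsc⟩ := Set.Infinite.exists_subset_card_eq hf (k + 1)
      exact ⟨s, hsc, hs⟩
  obtain ⟨s, hsc, hs⟩ := this
  refine not_injective_of_realize h x (fun i => (s.equivFinOfCardEq hsc).symm i)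
    (fun i => hs (Subtype.property _)) ?_
  exact Subtype.val_injective.comp (Equiv.injective _)

lemma exists_seq_of_transGen {α : Type*} {r : α → α → Prop} {x y : α} (h : Relation.TransGen r x y) :
    ∃ n : ℕ, 1 ≤ n ∧ ∃ f : ℕ → α, f 0 = x ∧ f n = y ∧ ∀ i < n, r (f i) (f (i + 1)) := by
  induction h using Relation.TransGen.head_induction_on with
  | @single x h =>
    refine ⟨1, le_rfl, fun i => if i = 0 then x else y, by simp, by simp, ?_⟩
    intro i hi
    obtain rfl : i = 0 := by omega
    simpa using h
  | @head x z h _ ih =>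
    obtain ⟨n, hn, f, h0, h1, hf⟩ := ih
    refine ⟨n + 1, by omega, fun i => Nat.casesOn i x f, rfl, h1, ?_⟩
    rintro (_ | i) hi
    · simpa [h0] using h
    · exact hf i (by omega)

lemma not_transGen_self (h : ∀ n : ℕ, 1 ≤ n → A ⊨ axC n) (x : A) :
    ¬ Relation.TransGen (fun v u : A => v ∈ extension u) x x := by
  intro hx
  obtain ⟨n, hn, f, h0, h1, hf⟩ := exists_seq_of_transGen hx
  have := h n hn
  simp only [axC, realize_sentence_alls,
    BoundedFormula.realize_not, BoundedFormula.realize_inf, BoundedFormula.realize_iInf,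
    realize_memF, realize_eqF] at this
  refine this (fun i => f i) ⟨fun i => ?_, ?_⟩
  · simpa using hf i i.2
  · simp [h0, h1]

theorem isBoundedSetModel_of_realize {k : ℕ} (h : A ⊨ theoryS k) : IsBoundedSetModel k A := by
  have hm : ∀ φ ∈ theoryS k, A ⊨ φ := fun φ hφ => h.realize_of_mem φ hφ
  have hB : A ⊨ axB k := hm _ (by simp [theoryS])
  refine ⟨fun Y hY hk => ?_, extension_injective_of_realize (hm _ (by simp [theoryS])),
    fun u => (finite_extension_and_ncard_le hB u).1,
    fun u => (finite_extension_and_ncard_le hB u).2,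
    not_transGen_self fun n hn => hm _ (Or.inr ⟨n, hn, rfl⟩)⟩
  -- The axiom for n = 0 gives the empty set; a nonempty set of at most k elements is listed with
  -- repetitions by a surjection from `Fin k`.
  rcases Y.eq_empty_or_nonempty with rfl | hne
  · obtain ⟨y, hy⟩ := exists_extension_eq_range (hm (axV 0) (by simp [theoryS]))
      (Fin.elim0 : Fin 0 → A)
    exact ⟨y, by simpa using hy⟩
  · have := hY.fintype
    have : Nonempty Y := hne.to_subtype
    have hcard : Fintype.card Y ≤ k := by
      rwa [← Nat.card_eq_fintype_card, Nat.card_coe_set_eq]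
    obtain ⟨e⟩ : Nonempty (Y ↪ Fin k) :=
      Function.Embedding.nonempty_of_card_le (by simpa using hcard)
    obtain ⟨y, hy⟩ := exists_extension_eq_range (hm (axV k) (by simp [theoryS]))
      (fun i => ((Function.invFun e i : Y) : A))
    refine ⟨y, hy.trans (Set.ext fun t => ⟨?_, fun ht => ?_⟩)⟩
    · rintro ⟨i, rfl⟩
      exact Subtype.property _
    · exact ⟨e ⟨t, ht⟩, by simp [Function.leftInverse_invFun e.injective _]⟩

/-! ### Levels of the transitive closure and their size -/

/-- The levels of the transitive closure of a set. -/
def level (S : Set A) : ℕ → Set A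
  | 0 => S
  | n + 1 => level S n ∪ ⋃ u ∈ level S n, extension u

lemma tclLevel_eq_level {l : ℕ} (a : Fin l → A) (n : ℕ) :
    tclLevel a n = level (Set.range a) n := by
  induction n with
  | zero => rfl
  | succ n ih => simp only [tclLevel, level, ih]

lemma level_mono (S : Set A) : Monotone (level S) :=
  monotone_nat_of_le_succ fun _ => Set.subset_union_left

lemma subset_level (S : Set A) (n : ℕ) : S ⊆ level S n :=
  level_mono S (Nat.zero_le n)

lemma mem_level_succ {S : Set A} {n : ℕ} {u v : A} (hu : u ∈ level S n) (hv : v ∈ extension u) :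
    v ∈ level S (n + 1) :=
  Or.inr (Set.mem_biUnion hu hv)

lemma mem_level_of_lt {S : Set A} {m n : ℕ} (h : m < n) {u v : A} (hu : u ∈ level S m)
    (hv : v ∈ extension u) : v ∈ level S n :=
  level_mono S h (mem_level_succ hu hv)

/-- With the base S split off, this gives |level (n+1)| ≤ |S| + k·|level n|, the recursion of
|S|·k^{≤n}. -/
lemma mem_level_succ_iff {S : Set A} {n : ℕ} {v : A} :
    v ∈ level S (n + 1) ↔ v ∈ S ∨ ∃ u ∈ level S n, v ∈ extension u := by
  induction n generalizing v with
  | zero => simp [level]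
  | succ n ih =>
    rw [level]
    simp only [Set.mem_union, Set.mem_iUnion, exists_prop]
    constructor
    · rintro (h | h)
      · exact (ih.1 h).imp_right fun ⟨u, hu, hv⟩ => ⟨u, level_mono S n.le_succ hu, hv⟩
      · exact Or.inr h
    · rintro (h | h)
      · exact Or.inl (subset_level S _ h)
      · exact Or.inr h

lemma level_union (S S' : Set A) (n : ℕ) : level (S ∪ S') n = level S n ∪ level S' n := by
  induction n with
  | zero => rfl
  | succ n ih =>
    simp only [level, ih, Set.biUnion_union]
    ext; simp only [Set.mem_union]; tauto

lemma powLE_succ (k n : ℕ) : powLE k (n + 1) = 1 + k * powLE k n := by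
  rw [powLE, powLE, Finset.sum_range_succ', Finset.mul_sum]
  simp [pow_succ', add_comm]

namespace IsBoundedSetModel

variable {k : ℕ} (hA : IsBoundedSetModel k A)
include hA

lemma finite_level_and_ncard_le {S : Set A} (hS : S.Finite) (n : ℕ) :
    (level S n).Finite ∧ (level S n).ncard ≤ S.ncard * powLE k n := by
  induction n with
  | zero => exact ⟨hS, by simp [level, powLE]⟩
  | succ n ih =>
    obtain ⟨hf, hc⟩ := ih
    have hEq : level S (n + 1) = S ∪ ⋃ u ∈ level S n, extension u := by
      ext v
      rw [mem_level_succ_iff]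
      simp
    have hU : (⋃ u ∈ level S n, extension u).Finite :=
      hf.biUnion fun u _ => hA.finite_extension u
    refine ⟨hEq ▸ hS.union hU, ?_⟩
    have h1 : (⋃ u ∈ level S n, extension u).ncard ≤ (level S n).ncard * k := by
      classical
      have : (⋃ u ∈ level S n, extension u)
          = ((hf.toFinset.biUnion fun u => (hA.finite_extension u).toFinset : Finset A) : Set A) := by
        ext; simp
      rw [this, Set.ncard_coe_finset, Set.ncard_eq_toFinset_card _ hf]
      refine Finset.card_biUnion_le_card_mul _ _ _ fun u _ => ?_
      rw [← Set.ncard_eq_toFinset_card _ (hA.finite_extension u)]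
      exact hA.ncard_extension_le u
    calc (level S (n + 1)).ncard ≤ S.ncard + (level S n).ncard * k := by
          rw [hEq]
          exact (Set.ncard_union_le _ _).trans (by gcongr)
      _ ≤ S.ncard + (S.ncard * powLE k n) * k := by gcongr
      _ = S.ncard * powLE k (n + 1) := by rw [powLE_succ]; ring

lemma finite_level {S : Set A} (hS : S.Finite) (n : ℕ) : (level S n).Finite :=
  (hA.finite_level_and_ncard_le hS n).1

lemma ncard_level_le {S : Set A} (hS : S.Finite) (n : ℕ) :
    (level S n).ncard ≤ S.ncard * powLE k n :=
  (hA.finite_level_and_ncard_le hS n).2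

end IsBoundedSetModel

/-! ### Isomorphisms as total maps -/

variable {B : Type*} [setLang.Structure B]

/-- On `X`, the map `f` preserves and reflects membership. -/
def PreservesMemOn (f : A → B) (X : Set A) : Prop :=
  ∀ u ∈ X, ∀ v ∈ X, (f v ∈ extension (f u) ↔ v ∈ extension u)

/-- Total maps, with arbitrary values off X, can be restricted and compared across levels without
changing type. -/
lemma pointedIso_iff [Nonempty B] {l : ℕ} (X : Set A) (Y : Set B) (a : Fin l → A) (b : Fin l → B) :
    PointedIso X Y a b ↔ ∃ f : A → B, Set.BijOn f X Y ∧ PreservesMemOn f X ∧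
      ∀ i, a i ∈ X ∧ f (a i) = b i := by
  classical
  constructor
  · rintro ⟨f, hf⟩
    let F : A → B := fun u => if h : u ∈ X then (f ⟨u, h⟩ : B) else Classical.arbitrary B
    have hF : ∀ u (h : u ∈ X), F u = (f ⟨u, h⟩ : B) := fun u h => dif_pos h
    refine ⟨F, ⟨fun u hu => ?_, fun u hu v hv huv => ?_, fun y hy => ?_⟩, fun u hu v hv => ?_,
      fun i => ?_⟩
    · rw [hF u hu]
      exact (f ⟨u, hu⟩).2
    · rw [hF u hu, hF v hv] at huv
      exact congrArg Subtype.val (f.injective (Subtype.ext huv))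
    · obtain ⟨⟨u, hu⟩, hu'⟩ := f.surjective ⟨y, hy⟩
      exact ⟨u, hu, by rw [hF u hu, hu']⟩
    · have := StrongHomClass.map_rel f memSym
        ![(⟨v, hv⟩ : toSubstructure X), ⟨u, hu⟩]
      rw [hF u hu, hF v hv]
      simp only [mem_extension_iff]
      have e1 : (![(f ⟨v, hv⟩ : B), f ⟨u, hu⟩]) =
          fun i => ((f ∘ ![(⟨v, hv⟩ : toSubstructure X), ⟨u, hu⟩]) i : B) := by
        funext i; fin_cases i <;> rfl
      have e2 : (![v, u]) =
          fun i => ((![(⟨v, hv⟩ : toSubstructure X), ⟨u, hu⟩]) i : A) := by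
        funext i; fin_cases i <;> rfl
      rw [e1, e2]
      exact this
    · obtain ⟨h, hi⟩ := hf i
      exact ⟨h, by rw [hF _ h, hi]⟩
  · rintro ⟨f, hbij, hmem, hf⟩
    refine ⟨⟨hbij.equiv f, fun g => g.elim, ?_⟩, fun i => ⟨(hf i).1, (hf i).2⟩⟩
    intro n r x
    cases r
    have e1 : (fun i => ((hbij.equiv f ∘ x) i : B)) = ![f (x 0), f (x 1)] := by
      funext i; fin_cases i <;> rfl
    have e2 : (fun i => (x i : A)) = ![(x 0 : A), x 1] := by
      funext i; fin_cases i <;> rfl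
    have := hmem (x 1) (x 1).2 (x 0) (x 0).2
    simp only [mem_extension_iff] at this
    rw [← e1, ← e2] at this
    exact this

end HSets

namespace HSets

/-! ### Formulas describing finite subsets -/

section QuantifierRank

variable {L : FirstOrder.Language} {α : Type*}

lemma qrank_inf {m : ℕ} (φ ψ : L.BoundedFormula α m) :
    qrank (φ ⊓ ψ) = max (qrank φ) (qrank ψ) := by
  simp [min, BoundedFormula.not, qrank]

lemma qrank_iInf_eq_zero {m : ℕ} {ι : Type*} [Finite ι] (φ : ι → L.BoundedFormula α m)
    (h : ∀ i, qrank (φ i) = 0) : qrank (BoundedFormula.iInf φ) = 0 := by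
  rw [BoundedFormula.iInf]
  generalize (@Finset.univ ι (Fintype.ofFinite ι)).toList = s
  induction s with
  | nil => simp [Top.top, BoundedFormula.not, qrank]
  | cons i s ih => simp only [List.map_cons, List.foldr_cons, qrank_inf, h, ih, max_self]

lemma qrank_exs {m : ℕ} (φ : L.BoundedFormula α m) : qrank φ.exs = qrank φ + m := by
  induction m with
  | zero => rfl
  | succ m ih =>
    rw [BoundedFormula.exs, ih]
    simp only [qrank]
    omega

end QuantifierRank

section Tuples

variable {α β : Type*} {l : ℕ}

lemma range_eq_image {a : Fin l → α} {b : Fin l → β} {f : α → β} (hf : ∀ i, f (a i) = b i) :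
    Set.range b = f '' Set.range a := by
  rw [← Set.range_comp]
  exact congrArg Set.range (funext fun i => (hf i).symm)

lemma range_snoc (a : Fin l → α) (c : α) :
    Set.range (Fin.snoc a c : Fin (l + 1) → α) = Set.range a ∪ {c} := by
  rw [Fin.range_snoc, Set.union_comm, Set.singleton_union]

end Tuples

variable {A B : Type*} [setLang.Structure A] [setLang.Structure B] {l m : ℕ}

/-- The tuples `x` and `y` satisfy the same atomic formulas. -/
def SameDiagram {ι : Type*} (x : ι → A) (y : ι → B) : Prop :=
  ∀ p q, (x p = x q ↔ y p = y q) ∧ (x p ∈ extension (x q) ↔ y p ∈ extension (y q))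

open Classical in
/-- The conjunction of the literals satisfied by the tuple `a` followed by `c`. -/
noncomputable def diagramFormula (a : Fin l → A) (c : Fin m → A) :
    setLang.BoundedFormula (Fin l) m :=
  BoundedFormula.iInf fun p : (Fin l ⊕ Fin m) × (Fin l ⊕ Fin m) =>
    (if Sum.elim a c p.1 = Sum.elim a c p.2 then
        Term.bdEqual (Term.var p.1) (Term.var p.2)
      else (Term.bdEqual (Term.var p.1) (Term.var p.2)).not) ⊓
    (if Sum.elim a c p.1 ∈ extension (Sum.elim a c p.2) then
        memSym.boundedFormula₂ (Term.var p.1) (Term.var p.2)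
      else (memSym.boundedFormula₂ (Term.var p.1) (Term.var p.2)).not)

lemma qrank_diagramFormula (a : Fin l → A) (c : Fin m → A) : qrank (diagramFormula a c) = 0 := by
  refine qrank_iInf_eq_zero _ fun p => ?_
  rw [qrank_inf]
  split_ifs <;> simp [Term.bdEqual, Relations.boundedFormula₂,
    Relations.boundedFormula, qrank]

lemma realize_diagramFormula (a : Fin l → A) (c : Fin m → A) (b : Fin l → B) (d : Fin m → B) :
    (diagramFormula a c).Realize b d ↔ SameDiagram (Sum.elim a c) (Sum.elim b d) := by
  simp only [diagramFormula, BoundedFormula.realize_iInf, BoundedFormula.realize_inf, SameDiagram,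
    Prod.forall]
  refine forall₂_congr fun p q => and_congr ?_ ?_
  · split_ifs with h <;> simp [h]
  · split_ifs with h <;> simp [h, BoundedFormula.realize_rel₂, ← mem_extension_iff]

lemma ElemEquivRank.symm {n : ℕ} {a : Fin l → A} {b : Fin l → B} (h : ElemEquivRank n a b) :
    ElemEquivRank n b a :=
  fun φ hφ => (h φ hφ).symm

/-- The quantifier-free diagram of c over a, preceded by m existential quantifiers, has rank m and
holds at a. -/
lemma ElemEquivRank.exists_sameDiagram {n : ℕ} {a : Fin l → A} {b : Fin l → B}
    (h : ElemEquivRank n a b) (hm : m ≤ n) (c : Fin m → A) :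
    ∃ d : Fin m → B, SameDiagram (Sum.elim a c) (Sum.elim b d) := by
  have hr : (diagramFormula a c).exs.Realize b := by
    rw [← h _ (by rw [qrank_exs, qrank_diagramFormula]; omega), BoundedFormula.realize_exs]
    exact ⟨c, (realize_diagramFormula a c a c).2 fun _ _ => ⟨Iff.rfl, Iff.rfl⟩⟩
  obtain ⟨d, hd⟩ := BoundedFormula.realize_exs.1 hr
  exact ⟨d, (realize_diagramFormula a c b d).1 hd⟩

lemma SameDiagram.exists_map {ι : Type*} [Nonempty B] {x : ι → A} {y : ι → B}
    (h : SameDiagram x y) :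
    ∃ f : A → B, (∀ p, f (x p) = y p) ∧ Set.InjOn f (Set.range x) ∧
      PreservesMemOn f (Set.range x) := by
  have hf : ∀ p, Function.extend x y (fun _ => Classical.arbitrary B) (x p) = y p :=
    fun p => Function.FactorsThrough.extend_apply (fun p q hpq => (h p q).1.1 hpq) _ p
  refine ⟨_, hf, ?_, ?_⟩
  · rintro _ ⟨p, rfl⟩ _ ⟨q, rfl⟩ hpq
    rw [hf, hf] at hpq
    exact (h p q).1.2 hpq
  · rintro _ ⟨p, rfl⟩ _ ⟨q, rfl⟩
    rw [hf, hf]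
    exact (h q p).2.symm

lemma PreservesMemOn.mono {f : A → B} {X Y : Set A} (h : PreservesMemOn f Y) (hXY : X ⊆ Y) :
    PreservesMemOn f X :=
  fun u hu v hv => h u (hXY hu) v (hXY hv)

lemma mapsTo_level {f : A → B} {S : Set A} {n : ℕ} (hf : PreservesMemOn f (level S n)) {j : ℕ}
    (hj : j ≤ n) : Set.MapsTo f (level S j) (level (f '' S) j) := by
  induction j with
  | zero => exact Set.mapsTo_image f S
  | succ j ih =>
    intro v hv
    rcases mem_level_succ_iff.1 hv with h | ⟨u, hu, hvu⟩
    · exact subset_level _ _ (Set.mem_image_of_mem f h)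
    · exact mem_level_succ (ih (by omega) hu)
        ((hf u (level_mono S (by omega) hu) v (level_mono S hj hv)).2 hvu)

/-- Only the points outside the tuple cost quantifiers. The map respects levels because it preserves
membership chains starting at the tuple. -/
lemma ElemEquivRank.exists_injOn {k n : ℕ} (hA : IsBoundedSetModel k A) [Nonempty B]
    {a : Fin l → A} {b : Fin l → B} (h : ElemEquivRank (l * (powLE k n - 1)) a b) :
    ∃ f : A → B, (∀ i, f (a i) = b i) ∧ Set.InjOn f (tclLevel a n) ∧
      PreservesMemOn f (tclLevel a n) ∧ Set.MapsTo f (tclLevel a n) (tclLevel b n) := by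
  have hS : (Set.range a).Finite := Set.finite_range a
  have hfin : (tclLevel a n).Finite := tclLevel_eq_level a n ▸ hA.finite_level hS n
  have hcard : (tclLevel a n \ Set.range a).ncard ≤ l * (powLE k n - 1) := by
    rw [tclLevel_eq_level, Set.ncard_sdiff (subset_level _ n) hS]
    calc (level (Set.range a) n).ncard - (Set.range a).ncard
        ≤ (Set.range a).ncard * powLE k n - (Set.range a).ncard :=
          Nat.sub_le_sub_right (hA.ncard_level_le hS n) _
      _ = (Set.range a).ncard * (powLE k n - 1) := by rw [Nat.mul_sub, mul_one]
      _ ≤ l * (powLE k n - 1) := by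
          gcongr
          rw [← Set.image_univ]
          exact (Set.ncard_image_le Set.finite_univ).trans (by simp)
  have hfin' := hfin.sdiff (t := Set.range a)
  have : Fintype (tclLevel a n \ Set.range a : Set A) := hfin'.fintype
  have hc : Fintype.card (tclLevel a n \ Set.range a : Set A) ≤ l * (powLE k n - 1) := by
    rwa [← Nat.card_eq_fintype_card, Nat.card_coe_set_eq]
  obtain ⟨d, hd⟩ := h.exists_sameDiagram hc
    (fun i => ((Fintype.equivFin (tclLevel a n \ Set.range a : Set A)).symm i : A))
  obtain ⟨f, hf, hinj, hmem⟩ := hd.exists_map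
  have hsub : tclLevel a n ⊆ Set.range (Sum.elim a
      (fun i => ((Fintype.equivFin (tclLevel a n \ Set.range a : Set A)).symm i : A))) := by
    intro u hu
    by_cases hua : u ∈ Set.range a
    · obtain ⟨i, rfl⟩ := hua
      exact ⟨Sum.inl i, rfl⟩
    · exact ⟨Sum.inr (Fintype.equivFin _ ⟨u, hu, hua⟩), by simp⟩
  have hfa : ∀ i, f (a i) = b i := fun i => hf (Sum.inl i)
  have hmem' := hmem.mono hsub
  refine ⟨f, hfa, hinj.mono hsub, hmem', ?_⟩
  rw [tclLevel_eq_level] at hmem' ⊢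
  rw [tclLevel_eq_level, range_eq_image hfa]
  exact mapsTo_level hmem' le_rfl

theorem ElemEquivRank.tclLevelIso {k n : ℕ} (hA : IsBoundedSetModel k A)
    (hB : IsBoundedSetModel k B) [Nonempty A] [Nonempty B] {a : Fin l → A} {b : Fin l → B}
    (h : ElemEquivRank (l * (powLE k n - 1)) a b) : TclLevelIso n a b := by
  obtain ⟨f, hfa, hinj, hmem, hmaps⟩ := h.exists_injOn hA
  obtain ⟨g, -, ginj, -, gmaps⟩ := h.symm.exists_injOn hB
  have hfinA : (tclLevel a n).Finite := tclLevel_eq_level a n ▸ hA.finite_level (Set.finite_range a) n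
  have hfinB : (tclLevel b n).Finite := tclLevel_eq_level b n ▸ hB.finite_level (Set.finite_range b) n
  -- The reverse embedding g serves only to compare cardinalities.
  have heq : f '' tclLevel a n = tclLevel b n := by
    refine Set.eq_of_subset_of_ncard_le hmaps.image_subset ?_ hfinB
    rw [hinj.ncard_image]
    exact Set.ncard_le_ncard_of_injOn g gmaps ginj hfinA
  refine (pointedIso_iff _ _ _ _).2 ⟨f, ⟨hmaps, hinj, heq.symm.subset⟩, hmem, fun i => ⟨?_, hfa i⟩⟩
  rw [tclLevel_eq_level]
  exact subset_level _ _ ⟨i, rfl⟩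

end HSets

namespace HSets

/-! ### Extending isomorphisms of levels of transitive closures by one element -/

variable {A B : Type*} [setLang.Structure A] [setLang.Structure B]

/-- The map `f` is an isomorphism of `level S n` onto `level (f '' S) n`. -/
structure IsLevelIso (f : A → B) (S : Set A) (n : ℕ) : Prop where
  injOn : Set.InjOn f (level S n)
  preservesMem : PreservesMemOn f (level S n)
  image_eq : f '' level S n = level (f '' S) n

lemma image_level_of_extension_eq {f : A → B} {S : Set A} {n : ℕ}
    (h : ∀ j < n, ∀ u ∈ level S j, extension (f u) = f '' extension u) :
    f '' level S n = level (f '' S) n := by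
  induction n with
  | zero => rfl
  | succ n ih =>
    rw [level, level, ← ih fun j hj => h j (by omega), Set.image_union, Set.image_iUnion₂,
      Set.biUnion_image]
    congr 1
    exact (Set.iUnion₂_congr fun u hu => h n n.lt_succ_self u hu).symm

namespace IsLevelIso

variable {f : A → B} {S : Set A} {n : ℕ} (hf : IsLevelIso f S n)
include hf

/-- Strictly below the top level all members of u and of f u are visible, so f commutes with forming
extensions. -/
lemma extension_eq {j : ℕ} (hj : j < n) {u : A} (hu : u ∈ level S j) :
    extension (f u) = f '' extension u := by
  have hu' : u ∈ level S n := level_mono S hj.le hu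
  ext y
  constructor
  · intro hy
    have : y ∈ f '' level S n := by
      rw [hf.image_eq]
      exact mem_level_of_lt hj (mapsTo_level hf.preservesMem hj.le hu) hy
    obtain ⟨v, hv, rfl⟩ := this
    exact ⟨v, (hf.preservesMem u hu' v hv).1 hy, rfl⟩
  · rintro ⟨v, hv, rfl⟩
    exact (hf.preservesMem u hu' v (mem_level_of_lt hj hu hv)).2 hv

lemma image_level_eq {j : ℕ} (hj : j ≤ n) : f '' level S j = level (f '' S) j :=
  image_level_of_extension_eq fun _ hi _ hu => hf.extension_eq (hi.trans_le hj) hu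

end IsLevelIso

/-! ### Heights, recursion and singleton towers -/

/-- The number of elements of `X` below `v` in the transitive closure of membership. -/
noncomputable def height (X : Set A) (v : A) : ℕ :=
  {w ∈ X | Relation.TransGen (fun v u : A => v ∈ extension u) w v}.ncard

/-- While the chain grows strictly, its i-th term has at least i elements. The bound on i later pays
for the levels spent reaching the gap. -/
lemma exists_eq_succ_of_monotone {α : Type*} {X : Set α} (hX : X.Finite) {Y : ℕ → Set α}
    (hY : Monotone Y) (hYX : ∀ i, Y i ⊆ X) : ∃ i, Y i = Y (i + 1) ∧ i ≤ (Y i).ncard := by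
  by_contra! hcon
  have : ∀ i, i ≤ (Y i).ncard := by
    intro i
    induction i with
    | zero => exact Nat.zero_le _
    | succ i ih =>
      have hne : Y i ≠ Y (i + 1) := fun h => (hcon i h).not_ge ih
      exact ih.trans_lt (Set.ncard_lt_ncard ((hY i.le_succ).ssubset_of_ne hne) (hX.subset (hYX _)))
  have h1 := this (X.ncard + 1)
  have h2 := Set.ncard_le_ncard (hYX (X.ncard + 1)) hX
  omega

namespace IsBoundedSetModel

lemma height_lt {k : ℕ} (hA : IsBoundedSetModel k A) {X : Set A} (hX : X.Finite) {v w : A}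
    (hw : w ∈ X) (hwv : w ∈ extension v) : height X w < height X v := by
  refine Set.ncard_lt_ncard ⟨fun x hx => ⟨hx.1, hx.2.tail hwv⟩, fun h => ?_⟩
    (hX.subset fun x hx => hx.1)
  exact hA.acyclic w (h ⟨hw, .single hwv⟩).2

lemma height_lt_ncard {k : ℕ} (hA : IsBoundedSetModel k A) {X : Set A} (hX : X.Finite) {v : A}
    (hv : v ∈ X) : height X v < X.ncard :=
  Set.ncard_lt_ncard ⟨fun _ hx => hx.1, fun h => hA.acyclic v (h hv).2⟩ hX

/-- Acyclicity makes membership restricted to the finite set X well-founded, and the image of an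
extension has at most k elements, so B contains it as a set. -/
lemma exists_recursive_map {k : ℕ} (hA : IsBoundedSetModel k A) (hB : IsBoundedSetModel k B)
    {X C : Set A} (hX : X.Finite) (hC : ∀ v ∈ C, extension v ⊆ X) (φ : A → B) :
    ∃ g : A → B, (∀ v ∈ C, extension (g v) = g '' extension v) ∧ ∀ v ∉ C, g v = φ v := by
  classical
  let R : A → A → Prop := fun w v => w ∈ X ∧ w ∈ extension v
  have hR : WellFounded R :=
    Subrelation.wf (fun {w v} h => hA.height_lt hX h.1 h.2) (measure (height X)).wf
  -- Totalised set formation; large sets get a junk value.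
  have hmk : ∀ Y : Set B, ∃ y : B, Y.Finite → Y.ncard ≤ k → extension y = Y := by
    intro Y
    by_cases hY : Y.Finite ∧ Y.ncard ≤ k
    · obtain ⟨y, hy⟩ := hB.exists_extension_eq Y hY.1 hY.2
      exact ⟨y, fun _ _ => hy⟩
    · obtain ⟨y, -⟩ := hB.exists_extension_eq ∅ Set.finite_empty (by simp)
      exact ⟨y, fun h1 h2 => absurd ⟨h1, h2⟩ hY⟩
  choose mk hmk using hmk
  let g : A → B := hR.fix fun v ih =>
    if v ∈ C then mk (Set.range fun w : {w // R w v} => ih w.1 w.2) else φ v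
  have hg : ∀ v, g v = if v ∈ C then mk (Set.range fun w : {w // R w v} => g w) else φ v :=
    fun v => hR.fix_eq _ v
  refine ⟨g, fun v hv => ?_, fun v hv => by rw [hg, if_neg hv]⟩
  have hset : (Set.range fun w : {w // R w v} => g w) = g '' extension v := by
    ext y
    constructor
    · rintro ⟨⟨w, hw⟩, rfl⟩
      exact ⟨w, hw.2, rfl⟩
    · rintro ⟨w, hw, rfl⟩
      exact ⟨⟨w, hC v hv hw, hw⟩, rfl⟩
  have hfin := hA.finite_extension v
  rw [hg v, if_pos hv, hset]
  exact hmk _ (hfin.image g) ((Set.ncard_image_le hfin).trans (hA.ncard_extension_le v))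

/-- Iterate singletons from the empty set; a repetition would be a cycle. -/
lemma exists_singleton_tower {k : ℕ} (hB : IsBoundedSetModel k B) (hk : 1 ≤ k) :
    ∃ σ : ℕ → B, Function.Injective σ ∧ ∀ q, extension (σ (q + 1)) = {σ q} := by
  obtain ⟨y, -⟩ := hB.exists_extension_eq ∅ Set.finite_empty (by simp)
  have hs : ∀ x : B, ∃ z : B, extension z = {x} := fun x =>
    hB.exists_extension_eq {x} (Set.finite_singleton x) (by simpa using hk)
  choose s hs using hs
  let σ : ℕ → B := fun q => s^[q] y
  have hσ : ∀ q, extension (σ (q + 1)) = {σ q} := fun q => by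
    simp only [σ, Function.iterate_succ_apply', hs]
  have hlt : ∀ i d, Relation.TransGen (fun v u : B => v ∈ extension u) (σ i) (σ (i + d + 1)) := by
    intro i d
    induction d with
    | zero => exact .single (by simp [hσ])
    | succ d ih => exact ih.tail (by rw [← add_assoc, hσ (i + d + 1)]; exact rfl)
  refine ⟨σ, ?_, hσ⟩
  have hne : ∀ i j, i < j → σ i ≠ σ j := by
    intro i j hij h
    obtain ⟨d, rfl⟩ := Nat.exists_eq_add_of_lt hij
    have := hlt i d
    rw [← h] at this
    exact hB.acyclic _ this
  intro i j h
  rcases lt_trichotomy i j with hij | hij | hij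
  · exact absurd h (hne i j hij)
  · exact hij
  · exact absurd h.symm (hne j i hij)

end IsBoundedSetModel

/-! ### Analysis of the rebuilt map -/

/-- The data of an isomorphism `f` between the `T`-th levels of two transitive closures, together
with a map `g` which agrees with `f` on the `s`-th level, sends the elements of `C` to the sets of
the images of their elements, and sends the other elements of the finite set `X` to members of a
tower `σ` of singletons that are far away from each other. -/
structure ExtensionData (k N M s T : ℕ) (f g : A → B) (S C X : Set A) (σ : ℕ → B)
    (idx : A → ℕ) : Prop where
  modelA : IsBoundedSetModel k A
  modelB : IsBoundedSetModel k B
  levelIso : IsLevelIso f S T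
  finite : X.Finite
  bound : (X \ level S s).ncard + s + 1 ≤ T
  bound' : (X \ level S s).ncard ≤ N
  gap : ∀ v ∈ X, v ∈ level S (s + 1) → v ∈ level S s
  subset : C ⊆ X \ level S s
  extension_subset : ∀ v ∈ C, extension v ⊆ X
  tower_injective : Function.Injective σ
  extension_tower : ∀ q, extension (σ (q + 1)) = {σ q}
  tower_notMem : ∀ q, M ≤ q → σ q ∉ level (f '' S) T
  idx_injOn : Set.InjOn idx X
  eq_old : ∀ v ∈ level S s, g v = f v
  extension_eq : ∀ v ∈ C, extension (g v) = g '' extension v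
  eq_tower : ∀ v ∈ X, v ∉ level S s → v ∉ C → g v = σ (M + N + 1 + idx v * (N + 1))

namespace ExtensionData

variable {k N M s T : ℕ} {f g : A → B} {S C X : Set A} {σ : ℕ → B} {idx : A → ℕ}
  (D : ExtensionData k N M s T f g S C X σ idx)
include D

lemma finite_new : (X \ level S s).Finite := D.finite.sdiff

lemma height_lt {v w : A} (hw : w ∈ X \ level S s) (hwv : w ∈ extension v) :
    height (X \ level S s) w < height (X \ level S s) v :=
  D.modelA.height_lt D.finite_new hw hwv

lemma height_lt_ncard {v : A} (hv : v ∈ X \ level S s) :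
    height (X \ level S s) v < (X \ level S s).ncard :=
  D.modelA.height_lt_ncard D.finite_new hv

lemma s_le : s ≤ T := by have := D.bound; omega

/-- Tower points avoid level T, so v is in C and g v = f v' for some v'. Members of v lie one level
deeper but the new ones have smaller height, so by induction f and g agree on them; extensionality
gives v = v'. -/
lemma eq_of_mem_level (n : ℕ) : ∀ v ∈ X \ level S s, height (X \ level S s) v = n →
    g v ∈ level (f '' S) (T - 1 - n) → v ∈ level S T ∧ g v = f v := by
  induction n using Nat.strong_induction_on with
  | _ n ih =>
    intro v hv hn hgv
    have hlt := D.height_lt_ncard hv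
    have hb := D.bound
    by_cases hvC : v ∈ C
    swap
    · rw [D.eq_tower v hv.1 hv.2 hvC] at hgv
      exact absurd (level_mono _ (by omega) hgv) (D.tower_notMem _ (by omega))
    have key : ∀ w ∈ extension v, g w ∈ level (f '' S) (T - n) → w ∈ level S T ∧ g w = f w := by
      intro w hw hgw
      by_cases hwO : w ∈ level S s
      · exact ⟨level_mono S D.s_le hwO, D.eq_old w hwO⟩
      · have hwN : w ∈ X \ level S s := ⟨D.extension_subset v hvC hw, hwO⟩
        have hh := D.height_lt hwN hw
        exact ih _ (hn ▸ hh) w hwN rfl (level_mono _ (by omega) hgw)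
    have hgv' := hgv
    rw [← D.levelIso.image_level_eq (by omega)] at hgv'
    obtain ⟨v', hv', hfv⟩ := hgv'
    have he : f '' extension v' = g '' extension v := by
      rw [← D.levelIso.extension_eq (by omega) hv', hfv, D.extension_eq v hvC]
    have hup : ∀ w ∈ extension v, g w ∈ level (f '' S) (T - n) := fun w hw =>
      mem_level_of_lt (by omega) hgv (by rw [D.extension_eq v hvC]; exact ⟨w, hw, rfl⟩)
    have hup' : ∀ w ∈ extension v', w ∈ level S T := fun w hw =>
      mem_level_of_lt (by omega) hv' hw
    have hvv : v = v' := by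
      refine D.modelA.extension_injective (Set.Subset.antisymm (fun w hw => ?_) fun w' hw' => ?_)
      · obtain ⟨h1, h2⟩ := key w hw (hup w hw)
        obtain ⟨w', hw', e⟩ := he.symm.subset ⟨w, hw, rfl⟩
        rw [h2] at e
        exact D.levelIso.injOn (hup' w' hw') h1 e ▸ hw'
      · obtain ⟨w, hw, e⟩ := he.subset ⟨w', hw', rfl⟩
        obtain ⟨h1, h2⟩ := key w hw (hup w hw)
        rw [h2] at e
        exact D.levelIso.injOn h1 (hup' w' hw') e ▸ hw
    rw [hvv]
    exact ⟨level_mono S (by omega) hv', by rw [hfv, hvv]⟩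

/-- The height of v is less than the number of new points, so `bound` gives T − 1 − height ≥ s + 1.
Then g v = f v puts v itself in level s + 1, against the gap. -/
lemma map_notMem_level {v : A} (hv : v ∈ X \ level S s) : g v ∉ level (f '' S) (s + 1) := by
  intro h
  have hlt := D.height_lt_ncard hv
  have hb := D.bound
  obtain ⟨h1, h2⟩ := D.eq_of_mem_level _ v hv rfl (level_mono _ (by omega) h)
  rw [h2, ← D.levelIso.image_level_eq (by omega)] at h
  obtain ⟨u, hu, e⟩ := h
  have := D.levelIso.injOn (level_mono S (by omega) hu) h1 e
  exact hv.2 (D.gap v hv.1 (this ▸ hu))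

lemma map_mem_level {v : A} (hv : v ∈ level S s) : g v ∈ level (f '' S) s := by
  rw [D.eq_old v hv, ← D.levelIso.image_level_eq D.s_le]
  exact ⟨v, hv, rfl⟩

/-- A rebuilt set equal to σ (q + 1) has a member sent to σ q, of smaller height. The descent ends
at a point p placed directly on the tower, after d steps. -/
lemma exists_of_eq_tower (n : ℕ) : ∀ v ∈ X \ level S s, height (X \ level S s) v = n →
    ∀ q, M + 1 + n ≤ q → g v = σ q →
    ∃ p d, d ≤ n ∧ q = M + N + 1 + idx p * (N + 1) + d ∧ (v ∈ C → 0 < d) := by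
  induction n using Nat.strong_induction_on with
  | _ n ih =>
    intro v hv hn q hq hgv
    by_cases hvC : v ∈ C
    swap
    · rw [D.eq_tower v hv.1 hv.2 hvC] at hgv
      exact ⟨v, 0, Nat.zero_le _, (D.tower_injective hgv).symm, fun h => absurd h hvC⟩
    obtain ⟨q, rfl⟩ : ∃ r, q = r + 1 := ⟨q - 1, by omega⟩
    have he := D.extension_eq v hvC
    rw [hgv, D.extension_tower] at he
    obtain ⟨w, hw, hgw⟩ := he.subset rfl
    have hwO : w ∉ level S s := fun h => D.tower_notMem q (by omega)
      (level_mono _ D.s_le (hgw ▸ D.map_mem_level h))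
    have hwN : w ∈ X \ level S s := ⟨D.extension_subset v hvC hw, hwO⟩
    have hh := D.height_lt hwN hw
    obtain ⟨p, d, hd, hq', -⟩ := ih _ (hn ▸ hh) w hwN rfl q (by omega) hgw
    exact ⟨p, d + 1, by omega, by omega, fun _ => d.succ_pos⟩

/-- A collision would put two assigned tower indices at distance d with 0 < d < N, but they are
multiples of N + 1 apart. -/
lemma map_ne_of_mem_of_notMem {u v : A} (hu : u ∈ C) (hv : v ∈ X \ level S s) (hvC : v ∉ C) :
    g u ≠ g v := by
  intro h
  rw [D.eq_tower v hv.1 hv.2 hvC] at h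
  have hlt := D.height_lt_ncard (D.subset hu)
  have hb := D.bound'
  obtain ⟨p, d, hd, hq, hpos⟩ := D.exists_of_eq_tower _ u (D.subset hu) rfl _ (by omega) h
  have hd0 := hpos hu
  have h1 : idx v * (N + 1) = idx p * (N + 1) + d := by omega
  rcases lt_or_ge (idx p) (idx v) with hpv | hpv
  · have : (idx p + 1) * (N + 1) ≤ idx v * (N + 1) := Nat.mul_le_mul_right _ hpv
    rw [add_mul] at this
    omega
  · have : idx v * (N + 1) ≤ idx p * (N + 1) := Nat.mul_le_mul_right _ hpv
    omega

/-- Induction on height: equal images of two rebuilt sets have equal images of members, which are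
matched by induction or by injectivity of f, and extensionality concludes. -/
lemma eq_of_map_eq_new (n : ℕ) : ∀ u ∈ X \ level S s, height (X \ level S s) u = n →
    ∀ v ∈ X \ level S s, g u = g v → u = v := by
  induction n using Nat.strong_induction_on with
  | _ n ih =>
    intro u hu hn v hv huv
    by_cases huC : u ∈ C <;> by_cases hvC : v ∈ C
    · have he : g '' extension u = g '' extension v := by
        rw [← D.extension_eq u huC, huv, D.extension_eq v hvC]
      have key : ∀ w ∈ extension u, ∀ w' ∈ extension v, g w = g w' → w = w' := by
        intro w hw w' hw' hww
        have hwX := D.extension_subset u huC hw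
        have hwX' := D.extension_subset v hvC hw'
        by_cases hwO : w ∈ level S s <;> by_cases hwO' : w' ∈ level S s
        · rw [D.eq_old w hwO, D.eq_old w' hwO'] at hww
          exact D.levelIso.injOn (level_mono S D.s_le hwO) (level_mono S D.s_le hwO') hww
        · exact absurd (level_mono _ s.le_succ (hww ▸ D.map_mem_level hwO))
            (D.map_notMem_level ⟨hwX', hwO'⟩)
        · exact absurd (level_mono _ s.le_succ (hww ▸ D.map_mem_level hwO'))
            (D.map_notMem_level ⟨hwX, hwO⟩)
        · exact ih _ (hn ▸ D.height_lt ⟨hwX, hwO⟩ hw) w ⟨hwX, hwO⟩ rfl w' ⟨hwX', hwO'⟩ hww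
      refine D.modelA.extension_injective (Set.Subset.antisymm (fun w hw => ?_) fun w' hw' => ?_)
      · obtain ⟨w', hw', e⟩ := he.subset ⟨w, hw, rfl⟩
        exact key w hw w' hw' e.symm ▸ hw'
      · obtain ⟨w, hw, e⟩ := he.symm.subset ⟨w', hw', rfl⟩
        exact key w hw w' hw' e ▸ hw
    · exact absurd huv (D.map_ne_of_mem_of_notMem huC hv hvC)
    · exact absurd huv.symm (D.map_ne_of_mem_of_notMem hvC hu huC)
    · rw [D.eq_tower u hu.1 hu.2 huC, D.eq_tower v hv.1 hv.2 hvC] at huv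
      have h1 := D.tower_injective huv
      have h2 : idx u * (N + 1) = idx v * (N + 1) := by omega
      exact D.idx_injOn hu.1 hv.1 (Nat.eq_of_mul_eq_mul_right N.succ_pos h2)

lemma injOn : Set.InjOn g (level S s ∪ X) := by
  have hcase : ∀ u ∈ level S s ∪ X, u ∈ level S s ∨ u ∈ X \ level S s := fun u hu => by
    by_cases h : u ∈ level S s
    · exact Or.inl h
    · exact Or.inr ⟨hu.resolve_left h, h⟩
  intro u hu v hv huv
  rcases hcase u hu with hu | hu <;> rcases hcase v hv with hv | hv
  · rw [D.eq_old u hu, D.eq_old v hv] at huv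
    exact D.levelIso.injOn (level_mono S D.s_le hu) (level_mono S D.s_le hv) huv
  · exact absurd (level_mono _ s.le_succ (huv ▸ D.map_mem_level hu)) (D.map_notMem_level hv)
  · exact absurd (level_mono _ s.le_succ (huv ▸ D.map_mem_level hv)) (D.map_notMem_level hu)
  · exact D.eq_of_map_eq_new _ u hu rfl v hv huv

lemma map_mem_extension_iff {u v : A} (hu : u ∈ level S s ∪ C) (hv : v ∈ level S s ∪ X) :
    g v ∈ extension (g u) ↔ v ∈ extension u := by
  have hb := D.bound
  rcases hu with hu | hu
  · by_cases hvO : v ∈ level S s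
    · rw [D.eq_old u hu, D.eq_old v hvO]
      exact D.levelIso.preservesMem u (level_mono S D.s_le hu) v (level_mono S D.s_le hvO)
    · have hvN : v ∈ X \ level S s := ⟨hv.resolve_left hvO, hvO⟩
      refine ⟨fun h => absurd (mem_level_succ (D.map_mem_level hu) h) (D.map_notMem_level hvN),
        fun h => absurd (D.gap v hvN.1 (mem_level_succ hu h)) hvO⟩
  · rw [D.extension_eq u hu]
    constructor
    · rintro ⟨w, hw, e⟩
      exact D.injOn (Or.inr (D.extension_subset u hu hw)) hv e ▸ hw
    · exact fun h => ⟨v, h, rfl⟩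

end ExtensionData

lemma isLevelIso_of_subsingleton [Subsingleton A] (hA : IsBoundedSetModel 0 A)
    (hB : IsBoundedSetModel 0 B) (f : A → B) (S : Set A) (n : ℕ) : IsLevelIso f S n := by
  have hA' : ∀ u : A, extension u = ∅ := fun u =>
    (Set.ncard_eq_zero (hA.finite_extension u)).1 (Nat.le_zero.1 (hA.ncard_extension_le u))
  have hB' : ∀ u : B, extension u = ∅ := fun u =>
    (Set.ncard_eq_zero (hB.finite_extension u)).1 (Nat.le_zero.1 (hB.ncard_extension_le u))
  exact ⟨fun _ _ _ _ _ => Subsingleton.elim _ _, fun u _ v _ => by simp [hA', hB'],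
    image_level_of_extension_eq fun _ _ u _ => by simp [hA', hB']⟩

/-! ### Extension by one point -/

theorem IsLevelIso.exists_extend {k t : ℕ} (hA : IsBoundedSetModel k A)
    (hB : IsBoundedSetModel k B) {f : A → B} {S : Set A} (hS : S.Finite)
    (hf : IsLevelIso f S (powLE k (t + 1) + t + 1)) (c : A) :
    ∃ g : A → B, Set.EqOn g f S ∧ IsLevelIso g (S ∪ {c}) t := by
  classical
  -- For k = 0 there are no singletons, hence no tower, but A is a single point.
  rcases Nat.eq_zero_or_pos k with rfl | hk
  · have : Subsingleton A := ⟨fun u v => hA.extension_injective <| by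
      rw [(Set.ncard_eq_zero (hA.finite_extension u)).1 (Nat.le_zero.1 (hA.ncard_extension_le u)),
        (Set.ncard_eq_zero (hA.finite_extension v)).1 (Nat.le_zero.1 (hA.ncard_extension_le v))]⟩
    exact ⟨f, fun _ _ => rfl, isLevelIso_of_subsingleton hA hB f _ t⟩
  set N := powLE k (t + 1) with hN
  set X : Set A := level {c} (t + 1) with hX
  have hXfin : X.Finite := hA.finite_level (Set.finite_singleton c) _
  have hXcard : X.ncard ≤ N := by
    simpa using hA.ncard_level_le (Set.finite_singleton c) (t + 1)
  -- The gap occurs at depth s = t + i.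
  obtain ⟨i, hi, hicard⟩ := exists_eq_succ_of_monotone hXfin
    (Y := fun i => X ∩ level S (t + i))
    (fun i j hij => Set.inter_subset_inter_right X (level_mono S (by omega)))
    (fun i => Set.inter_subset_left)
  have hnew : (X \ level S (t + i)).ncard + i ≤ N := by
    have := Set.ncard_inter_add_ncard_sdiff_eq_ncard X (level S (t + i)) hXfin
    have h2 : i ≤ (X ∩ level S (t + i)).ncard := hicard
    omega
  obtain ⟨σ, hσ, hσe⟩ := hB.exists_singleton_tower hk
  have hM : ∃ M, ∀ q, M ≤ q → σ q ∉ level (f '' S) (N + t + 1) := by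
    have hfin : (σ ⁻¹' level (f '' S) (N + t + 1)).Finite :=
      (hB.finite_level (hS.image f) _).preimage hσ.injOn
    obtain ⟨M, hM⟩ := hfin.bddAbove
    exact ⟨M + 1, fun q hq hmem => by have := hM hmem; omega⟩
  obtain ⟨M, hM⟩ := hM
  obtain ⟨idx, hidx⟩ := Set.countable_iff_exists_injOn.1 hXfin.countable
  -- Members of points of C remain in X. The offset N + 1 keeps every descent of at most N steps
  -- above M; the factor N + 1 separates different points.
  obtain ⟨g, hgC, hgφ⟩ := hA.exists_recursive_map hB (C := level {c} t \ level S (t + i)) hXfin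
    (fun v hv w hw => mem_level_succ hv.1 hw)
    (fun v => if v ∈ level S (t + i) then f v else σ (M + N + 1 + idx v * (N + 1)))
  have D : ExtensionData k N M (t + i) (N + t + 1) f g S (level {c} t \ level S (t + i)) X σ idx :=
    { modelA := hA
      modelB := hB
      levelIso := hf
      finite := hXfin
      bound := by omega
      bound' := by omega
      gap := fun v hv h => (hi.symm.subset ⟨hv, h⟩).2
      subset := fun v hv => ⟨level_mono _ t.le_succ hv.1, hv.2⟩
      extension_subset := fun v hv w hw => mem_level_succ hv.1 hw
      tower_injective := hσ
      extension_tower := hσe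
      tower_notMem := hM
      idx_injOn := hidx
      eq_old := fun v hv => by rw [hgφ v fun h => h.2 hv, if_pos hv]
      extension_eq := hgC
      eq_tower := fun v _ hvO hvC => by rw [hgφ v hvC, if_neg hvO] }
  have hsub : level (S ∪ {c}) t ⊆ level S (t + i) ∪ (level {c} t \ level S (t + i)) := by
    rw [level_union, Set.union_sdiff_self]
    exact Set.union_subset_union_left _ (level_mono S (by omega))
  have hsub' : level (S ∪ {c}) t ⊆ level S (t + i) ∪ X :=
    hsub.trans (Set.union_subset_union_right _ fun v hv => (D.subset hv).1)
  refine ⟨g, fun v hv => D.eq_old v (subset_level _ _ hv), D.injOn.mono hsub',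
    fun u hu v hv => D.map_mem_extension_iff (hsub hu) (hsub' hv),
    image_level_of_extension_eq fun j hj u hu => ?_⟩
  -- For an old point with only old members, g inherits from f that it commutes with extensions, as
  -- t + i < T.
  have hold : u ∈ level S (t + i) → extension u ⊆ level S (t + i) →
      extension (g u) = g '' extension u := by
    intro h1 h2
    rw [D.eq_old u h1, hf.extension_eq (by have := D.bound; omega) h1]
    exact Set.image_congr fun w hw => (D.eq_old w (h2 hw)).symm
  rw [level_union] at hu
  rcases hu with hu | hu
  · exact hold (level_mono S (by omega) hu) fun w hw => mem_level_of_lt (by omega) hu hw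
  · by_cases huO : u ∈ level S (t + i)
    · exact hold huO fun w hw =>
        D.gap w (mem_level_of_lt (by omega) hu hw) (mem_level_succ huO hw)
    · exact hgC u ⟨level_mono _ hj.le hu, huO⟩

end HSets

namespace HSets

/-! ### Back and forth -/

variable {A B : Type*} [setLang.Structure A] [setLang.Structure B]

lemma tclLevelIso_iff [Nonempty B] {l n : ℕ} (a : Fin l → A) (b : Fin l → B) :
    TclLevelIso n a b ↔ ∃ f : A → B, IsLevelIso f (Set.range a) n ∧ ∀ i, f (a i) = b i := by
  rw [TclLevelIso, pointedIso_iff, tclLevel_eq_level, tclLevel_eq_level]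
  constructor
  · rintro ⟨f, hbij, hmem, hf⟩
    exact ⟨f, ⟨hbij.injOn, hmem, by
      rw [hbij.image_eq, range_eq_image fun i => (hf i).2]⟩, fun i => (hf i).2⟩
  · rintro ⟨f, h, hf⟩
    refine ⟨f, ?_, h.preservesMem, fun i => ⟨subset_level _ _ ⟨i, rfl⟩, hf i⟩⟩
    rw [range_eq_image hf, ← h.image_eq]
    exact h.injOn.bijOn_image

lemma TclLevelIso.symm [Nonempty A] [Nonempty B] {l n : ℕ} {a : Fin l → A} {b : Fin l → B}
    (h : TclLevelIso n a b) : TclLevelIso n b a := by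
  obtain ⟨f, hf⟩ := h
  refine ⟨f.symm, fun i => ?_⟩
  obtain ⟨h, hi⟩ := hf i
  have hb : b i ∈ toSubstructure (tclLevel b n) := hi ▸ (f ⟨a i, h⟩).2
  refine ⟨hb, ?_⟩
  have : (⟨b i, hb⟩ : toSubstructure (tclLevel b n)) = f ⟨a i, h⟩ := Subtype.ext hi.symm
  rw [this, Language.Equiv.symm_apply_apply]

lemma TclLevelIso.exists_snoc [Nonempty B] {k l n : ℕ} (hA : IsBoundedSetModel k A)
    (hB : IsBoundedSetModel k B) {a : Fin l → A} {b : Fin l → B}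
    (h : TclLevelIso (tBound k (n + 1)) a b) (c : A) :
    ∃ d : B, TclLevelIso (tBound k n) (Fin.snoc a c : Fin (l + 1) → A) (Fin.snoc b d) := by
  obtain ⟨f, hf, hfa⟩ := (tclLevelIso_iff a b).1 h
  obtain ⟨g, hgf, hg⟩ := hf.exists_extend hA hB (Set.finite_range a) c
  refine ⟨g c, (tclLevelIso_iff _ _).2 ⟨g, by rwa [range_snoc], fun i => ?_⟩⟩
  refine Fin.lastCases ?_ (fun i => ?_) i
  · simp only [Fin.snoc_last]
  · simp only [Fin.snoc_castSucc]
    rw [hgf ⟨i, rfl⟩, hfa]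

lemma sumElim_eq_append {α : Type*} {l m : ℕ} (a : Fin l → α) (x : Fin m → α) (p : Fin l ⊕ Fin m) :
    Sum.elim a x p = Fin.append a x (finSumFinEquiv p) := by
  rcases p with p | p <;> simp

lemma append_default {α : Type*} {l : ℕ} (v : Fin l → α) :
    Fin.append v (default : Fin 0 → α) = v := by
  rw [Subsingleton.elim (default : Fin 0 → α) Fin.elim0, Fin.append_elim0]
  rfl

lemma exists_eq_var {α : Type*} {m : ℕ} (t : setLang.Term (α ⊕ Fin m)) :
    ∃ p, t = Term.var p := by
  cases t with
  | var p => exact ⟨p, rfl⟩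
  | func f => exact f.elim

/-- Free and bound variables are merged into one tuple; each quantifier is one extension move,
lowering the level from t_k(n+1) to t_k(n). -/
theorem realize_iff_of_tclLevelIso [Nonempty A] [Nonempty B] {k l m : ℕ}
    (hA : IsBoundedSetModel k A) (hB : IsBoundedSetModel k B)
    (φ : setLang.BoundedFormula (Fin l) m) :
    ∀ (n : ℕ) (a : Fin l → A) (b : Fin l → B) (x : Fin m → A) (y : Fin m → B), qrank φ ≤ n →
      TclLevelIso (tBound k n) (Fin.append a x) (Fin.append b y) →
      (φ.Realize a x ↔ φ.Realize b y) := by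
  induction φ with
  | falsum => exact fun _ _ _ _ _ _ _ => Iff.rfl
  | @equal m t₁ t₂ =>
    intro n a b x y _ h
    obtain ⟨p, rfl⟩ := exists_eq_var t₁
    obtain ⟨q, rfl⟩ := exists_eq_var t₂
    obtain ⟨f, hf, hfa⟩ := (tclLevelIso_iff _ _).1 h
    simp only [BoundedFormula.Realize, Term.realize_var, sumElim_eq_append, ← hfa]
    exact (hf.injOn.eq_iff (subset_level _ _ ⟨_, rfl⟩) (subset_level _ _ ⟨_, rfl⟩)).symm
  | @rel m r R ts =>
    intro n a b x y _ h
    obtain ⟨f, hf, hfa⟩ := (tclLevelIso_iff _ _).1 h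
    cases R
    obtain ⟨p, hp⟩ := exists_eq_var (ts 0)
    obtain ⟨q, hq⟩ := exists_eq_var (ts 1)
    obtain rfl : ts = ![Term.var p, Term.var q] := by
      funext i; fin_cases i
      · exact hp
      · exact hq
    change (memSym.boundedFormula₂ (Term.var p) (Term.var q)).Realize a x ↔
      (memSym.boundedFormula₂ (Term.var p) (Term.var q)).Realize b y
    simp only [BoundedFormula.realize_rel₂, Term.realize_var, ← mem_extension_iff,
      sumElim_eq_append, ← hfa]
    exact (hf.preservesMem _ (subset_level _ _ ⟨_, rfl⟩) _ (subset_level _ _ ⟨_, rfl⟩)).symm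
  | imp φ ψ ihφ ihψ =>
    intro n a b x y hn h
    rw [qrank] at hn
    rw [BoundedFormula.realize_imp, BoundedFormula.realize_imp,
      ihφ n a b x y ((le_max_left _ _).trans hn) h, ihψ n a b x y ((le_max_right _ _).trans hn) h]
  | all φ ih =>
    intro n a b x y hn h
    rw [qrank] at hn
    obtain ⟨n, rfl⟩ : ∃ n', n = n' + 1 := ⟨n - 1, by omega⟩
    rw [BoundedFormula.realize_all, BoundedFormula.realize_all]
    constructor
    · intro hall d
      obtain ⟨c, hc⟩ := h.symm.exists_snoc hB hA d
      rw [← Fin.append_snoc, ← Fin.append_snoc] at hc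
      exact (ih n a b _ _ (by omega) hc.symm).1 (hall c)
    · intro hall c
      obtain ⟨d, hd⟩ := h.exists_snoc hA hB c
      rw [← Fin.append_snoc, ← Fin.append_snoc] at hd
      exact (ih n a b _ _ (by omega) hd).2 (hall d)

theorem TclLevelIso.elemEquivRank [Nonempty A] [Nonempty B] {k l n : ℕ}
    (hA : IsBoundedSetModel k A) (hB : IsBoundedSetModel k B) {a : Fin l → A} {b : Fin l → B}
    (h : TclLevelIso (tBound k n) a b) : ElemEquivRank n a b := by
  intro φ hφ
  refine realize_iff_of_tclLevelIso hA hB φ n a b default default hφ ?_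
  rw [append_default, append_default]
  exact h

/-! ### The whole transitive closure -/

lemma tcl_eq_iUnion_level {l : ℕ} (a : Fin l → A) : tcl a = ⋃ n, level (Set.range a) n :=
  Set.iUnion_congr fun n => tclLevel_eq_level a n

lemma TclIso.tclLevelIso [Nonempty B] {l : ℕ} {a : Fin l → A} {b : Fin l → B} (h : TclIso a b)
    (n : ℕ) : TclLevelIso n a b := by
  obtain ⟨f, hbij, hmem, hf⟩ := (pointedIso_iff _ _ _ _).1 h
  have hsub : ∀ n, level (Set.range a) n ⊆ tcl a := fun n => by
    rw [tcl_eq_iUnion_level]; exact Set.subset_iUnion _ n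
  refine (tclLevelIso_iff a b).2 ⟨f, ⟨hbij.injOn.mono (hsub n), hmem.mono (hsub n),
    image_level_of_extension_eq fun j _ u hu => ?_⟩, fun i => (hf i).2⟩
  ext y
  constructor
  · intro hy
    have hfu := mapsTo_level (hmem.mono (hsub j)) le_rfl hu
    rw [← range_eq_image fun i => (hf i).2] at hfu
    have : y ∈ tcl b := by
      rw [tcl_eq_iUnion_level]
      exact Set.mem_iUnion.2 ⟨j + 1, mem_level_succ hfu hy⟩
    obtain ⟨v, hv, rfl⟩ := hbij.surjOn this
    exact ⟨v, (hmem u (hsub j hu) v hv).1 hy, rfl⟩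
  · rintro ⟨v, hv, rfl⟩
    exact (hmem u (hsub j hu) v (hsub (j + 1) (mem_level_succ hu hv))).2 hv

/-- Pointwise limits of isomorphisms of levels along an ultrafilter are isomorphisms. -/
theorem tclIso_of_forall_tclLevelIso [Nonempty B] {k l : ℕ}
    (hB : IsBoundedSetModel k B) {a : Fin l → A} {b : Fin l → B}
    (h : ∀ n, TclLevelIso n a b) : TclIso a b := by
  choose F hF hFa using fun n => (tclLevelIso_iff a b).1 (h n)
  have hran : ∀ n, F n '' Set.range a = Set.range b := fun n => (range_eq_image (hFa n)).symm
  have himg : ∀ {m n}, m ≤ n → F n '' level (Set.range a) m = level (Set.range b) m :=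
    fun {m n} hmn => by rw [(hF n).image_level_eq hmn, hran]
  let U : Ultrafilter ℕ := Filter.hyperfilter ℕ
  have hge : ∀ m : ℕ, ∀ᶠ n in U, m ≤ n := fun m =>
    (Nat.hyperfilter_le_atTop) (Filter.eventually_ge_atTop m)
  have hlim : ∀ u, ∃ y : B, u ∈ tcl a → ∀ᶠ n in U, F n u = y := by
    intro u
    by_cases hu : u ∈ tcl a
    · rw [tcl_eq_iUnion_level] at hu
      obtain ⟨m, hm⟩ := Set.mem_iUnion.1 hu
      -- The values at u stay in one finite level, so the ultrafilter selects one of them.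
      have hev : ∀ᶠ n in U, ∃ y ∈ level (Set.range b) m, F n u = y :=
        (hge m).mono fun n hn => ⟨F n u, (himg hn).subset ⟨u, hm, rfl⟩, rfl⟩
      obtain ⟨y, -, hy⟩ := (U.eventually_exists_mem_iff
        (hB.finite_level (Set.finite_range b) m)).1 hev
      exact ⟨y, fun _ => hy⟩
    · exact ⟨Classical.arbitrary B, fun h => absurd h hu⟩
  choose f hf using hlim
  have hmem : ∀ {u}, u ∈ tcl a ↔ ∃ m, u ∈ level (Set.range a) m := fun {u} => by
    rw [tcl_eq_iUnion_level, Set.mem_iUnion]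
  have hlev : ∀ u ∈ tcl a, ∀ᶠ n in U, u ∈ level (Set.range a) n := by
    intro u hu
    obtain ⟨m, hm⟩ := hmem.1 hu
    exact (hge m).mono fun n hn => level_mono _ hn hm
  have hrange : ∀ i, a i ∈ tcl a := fun i => hmem.2 ⟨0, i, rfl⟩
  refine (pointedIso_iff _ _ _ _).2 ⟨f, ⟨fun u hu => ?_, fun u hu v hv huv => ?_, fun y hy => ?_⟩,
    fun u hu v hv => ?_, fun i => ⟨hrange i, ?_⟩⟩
  · obtain ⟨m, hm⟩ := hmem.1 hu
    obtain ⟨n, hn, hfn⟩ := ((hge m).and (hf u hu)).exists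
    rw [tcl_eq_iUnion_level, ← hfn]
    exact Set.mem_iUnion.2 ⟨m, (himg hn).subset ⟨u, hm, rfl⟩⟩
  · obtain ⟨n, ⟨hu', hv'⟩, h1, h2⟩ :=
      (((hlev u hu).and (hlev v hv)).and ((hf u hu).and (hf v hv))).exists
    exact (hF n).injOn hu' hv' (by rw [h1, h2, huv])
  · rw [tcl_eq_iUnion_level] at hy
    obtain ⟨m, hm⟩ := Set.mem_iUnion.1 hy
    have hfin : (level (Set.range a) m).Finite := by
      refine Set.Finite.of_finite_image ?_ (hF m).injOn
      rw [himg le_rfl]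
      exact hB.finite_level (Set.finite_range b) m
    -- For surjectivity, the ultrafilter selects a preimage of y in a finite level.
    have hev : ∀ᶠ n in U, ∃ u ∈ level (Set.range a) m, F n u = y :=
      (hge m).mono fun n hn => (himg hn).symm.subset hm
    obtain ⟨u, hu, hy⟩ := (U.eventually_exists_mem_iff hfin).1 hev
    obtain ⟨n, h1, h2⟩ := (hy.and (hf u (hmem.2 ⟨m, hu⟩))).exists
    exact ⟨u, hmem.2 ⟨m, hu⟩, by rw [← h2, h1]⟩
  · obtain ⟨n, ⟨hu', hv'⟩, h1, h2⟩ :=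
      (((hlev u hu).and (hlev v hv)).and ((hf u hu).and (hf v hv))).exists
    rw [← h1, ← h2]
    exact (hF n).preservesMem u hu' v hv'
  · obtain ⟨n, hn⟩ := (hf (a i) (hrange i)).exists
    rw [← hn, hFa]

end HSets


theorem mainTheorem2 (k l : ℕ) {A B : Type*}
    [HSets.setLang.Structure A] [HSets.setLang.Structure B]
    (hA : A ⊨ HSets.theoryS k) (hB : B ⊨ HSets.theoryS k)
    (a : Fin l → A) (b : Fin l → B) :
    (HSets.ElemEquiv a b ↔ HSets.TclIso a b) ∧
    ∀ n : ℕ,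
      (HSets.ElemEquivRank (l * (HSets.powLE k n - 1)) a b → HSets.TclLevelIso n a b) ∧
      (HSets.TclLevelIso (HSets.tBound k n) a b → HSets.ElemEquivRank n a b) := by
  have hA' := HSets.isBoundedSetModel_of_realize hA
  have hB' := HSets.isBoundedSetModel_of_realize hB
  have : Nonempty A := ⟨(hA'.exists_extension_eq ∅ Set.finite_empty (by simp)).choose⟩
  have : Nonempty B := ⟨(hB'.exists_extension_eq ∅ Set.finite_empty (by simp)).choose⟩
  refine ⟨⟨fun h => HSets.tclIso_of_forall_tclLevelIso hB' fun n =>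
    HSets.ElemEquivRank.tclLevelIso hA' hB' fun φ _ => h φ, fun h φ => ?_⟩,
    fun n => ⟨fun h => h.tclLevelIso hA' hB', fun h => h.elemEquivRank hA' hB'⟩⟩
  exact (h.tclLevelIso (HSets.tBound k (HSets.qrank φ))).elemEquivRank hA' hB' φ le_rfl
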